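/- Let $\mathcal X$ be a Polish space with its Borel $\sigma$-field, equipped with a closed partial order $\le$ (that is, $\{(x,y): x\le y\}$ is closed in $\mathcal X\times\mathcal X$) having a bottom element $\hat 0$ and a top element $\hat 1$. Let $\pi$ be a probability measure on $\mathcal X$ with $\pi(\{\hat 0\})>0$, and let $K$ be a Markov kernel on $\mathcal X$ with stationary distribution $\pi$ which is stochastically monotone: $K(x,B)\ge K(y,B)$ whenever $x\le y$ and $B$ is a closed down-set. Let $\widetilde K$ be a Markov kernel that is a time-reversal of $K$: $\pi(dx)K(x,dy)=\pi(dy)\widetilde K(y,dx)$ on $\mathcal X\times\mathcal X$. Let $M_{xy}(x',\cdot)$ be probability measures on $\mathcal X$ such that $M_{xy}(x',B)$ is jointly measurable in $(x,y,x')\in\mathcal X^3$ for each Borel set $B$ and such that, whenever $x\le y$, the measure $M_{xy}(x',\cdot)$ is supported on $\{y'\in\mathcal X : y'\ge x'\}$ for every $x'$, and $$K(y,\cdot)=\int K(x,dx')\,M_{xy}(x',\cdot).$$ Fix a positive integer $t$ and consider the following routine. Set $\mathbf X_t=\hat 0$ and draw successively $\mathbf X_{t-1}\sim\widetilde K(\mathbf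 X_t,\cdot)$, …, $\mathbf X_0\sim\widetilde K(\mathbf X_1,\cdot)$. Given $(\mathbf X_0,\dots,\mathbf X_t)=(x_0,\dots,x_t)$, draw $(\mathbf Y_0,\dots,\mathbf Y_t)$ from $$\delta_{\hat 1}(dy_0)\,M_{x_0,y_0}(x_1,dy_1)\cdots M_{x_{t-1},y_{t-1}}(x_t,dy_t).$$ Let $\mathbf C=\{\mathbf Y_t=\hat 0\}$ be the event that $\mathbf X_0$ is accepted, and assume $\mathbf P(\mathbf C)>0$. Then: 1. The conditional law of the accepted value is $\pi$: $\mathcal L(\mathbf X_0\mid\mathbf C)=\pi$. 2. If the routine is repeated independently (with the same $t$, always from $\mathbf X_t=\hat 0$) until the first acceptance, then almost surely an acceptance occurs, and the value $\mathbf X_0$ of the first accepted run has law exactly $\pi$. -/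

import Mathlib

open MeasureTheory ProbabilityTheory

namespace PerfectSampling

/-- `ν₁ ≼ ν₂` stochastically: `ν₁ B ≥ ν₂ B` for every closed down-set `B`. -/
def StochLE {𝒳 : Type*} [TopologicalSpace 𝒳] [MeasurableSpace 𝒳] [PartialOrder 𝒳]
    (ν₁ ν₂ : Measure 𝒳) : Prop :=
  ∀ B : Set 𝒳, IsClosed B → IsLowerSet B → ν₂ B ≤ ν₁ B

/-- A kernel is stochastically monotone if `K x ≼ K y` whenever `x ≤ y`. -/
def StochMonotone {𝒳 : Type*} [TopologicalSpace 𝒳] [MeasurableSpace 𝒳] [PartialOrder 𝒳]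
    (K : Kernel 𝒳 𝒳) : Prop :=
  ∀ x y : 𝒳, x ≤ y → StochLE (K x) (K y)

/-- `K'` is a time-reversal of `K` with respect to `π`:
`π(dx) K(x, dy) = π(dy) K'(y, dx)` as measures on `𝒳 × 𝒳`. -/
def IsTimeReversal {𝒳 : Type*} [MeasurableSpace 𝒳] (π : Measure 𝒳) (K K' : Kernel 𝒳 𝒳) : Prop :=
  π.compProd K = (π.compProd K').map Prod.swap

/-- A jointly measurable family `M_{xy}(x', ·) = M (x, y, x')` of Markov kernels is a family of
upward kernels for `K` if, for all `x ≤ y`, the measure `M_{xy}(x', ·)` is supported on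
`{y' | x' ≤ y'}` for every `x'`, and `K(y, ·) = ∫ K(x, dx') M_{xy}(x', ·)`.
Nothing is required when `x ≤ y` fails. -/
def IsUpwardFamily {𝒳 : Type*} [MeasurableSpace 𝒳] [PartialOrder 𝒳]
    (K : Kernel 𝒳 𝒳) (M : Kernel (𝒳 × 𝒳 × 𝒳) 𝒳) : Prop :=
  ∀ x y : 𝒳, x ≤ y →
    (∀ x' : 𝒳, M (x, y, x') (Set.Ici x')ᶜ = 0) ∧
    K y = (K x).bind (fun x' => M (x, y, x'))

/-- Trajectories `(x_0, …, x_t)`. -/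
abbrev Path (𝒳 : Type*) (t : ℕ) : Type _ := Fin (t + 1) → 𝒳

theorem measurable_snoc {𝒳 : Type*} [MeasurableSpace 𝒳] (t : ℕ) :
    Measurable (fun p : Path 𝒳 t × 𝒳 => (Fin.snoc p.1 p.2 : Path 𝒳 (t + 1))) := by
  refine measurable_pi_iff.2 fun i => ?_
  refine Fin.lastCases ?_ (fun j => ?_) i
  · simpa using measurable_snd
  · simp only [Fin.snoc_castSucc]
    exact (measurable_pi_apply j).comp measurable_fst

theorem measurable_init {𝒳 : Type*} [MeasurableSpace 𝒳] (t : ℕ) :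
    Measurable (fun x : Path 𝒳 (t + 1) => (Fin.init x : Path 𝒳 t)) :=
  measurable_pi_iff.2 fun i => measurable_pi_apply i.castSucc

theorem measurable_lastStep {𝒳 : Type*} [MeasurableSpace 𝒳] (t : ℕ) :
    Measurable (fun p : Path 𝒳 (t + 1) × Path 𝒳 t =>
      (p.1 (Fin.last t).castSucc, p.2 (Fin.last t), p.1 (Fin.last (t + 1)))) := by
  fun_prop

noncomputable section

/-- The backward phase: `backward K' t z` is the law of `(X_0, …, X_t)` obtained by setting
`X_t = z` and then drawing `X_{t-1}` from `K'(X_t, ·)`, …, `X_0` from `K'(X_1, ·)`.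
To make `t + 1` backward steps from `z`, make one step to a random state `z₁`, make `t` further
steps from `z₁`, and put `z` at the end of the trajectory. -/
def backward {𝒳 : Type*} [MeasurableSpace 𝒳] (K' : Kernel 𝒳 𝒳) : (t : ℕ) → Kernel 𝒳 (Path 𝒳 t)
  | 0 => Kernel.deterministic (fun z _ => z) (measurable_pi_iff.2 fun _ => measurable_id)
  | t + 1 => (((backward K' t).comp K').prod Kernel.id).map
      (fun p => (Fin.snoc p.1 p.2 : Path 𝒳 (t + 1)))

/-- The forward phase: `forward M t x` is the law of `(Y_0, …, Y_t)` given the trajectory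
`x = (x_0, …, x_t)`, namely
`δ_⊤(dy_0) M_{x_0 y_0}(x_1, dy_1) ⋯ M_{x_{t-1} y_{t-1}}(x_t, dy_t)`. -/
def forward {𝒳 : Type*} [MeasurableSpace 𝒳] [PartialOrder 𝒳] [BoundedOrder 𝒳]
    (M : Kernel (𝒳 × 𝒳 × 𝒳) 𝒳) : (t : ℕ) → Kernel (Path 𝒳 t) (Path 𝒳 t)
  | 0 => Kernel.const _ (Measure.dirac (fun _ => ⊤))
  | t + 1 =>
      (((forward M t).comap Fin.init (measurable_init t)).compProd
        (M.comap (fun p : Path 𝒳 (t + 1) × Path 𝒳 t =>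
            (p.1 (Fin.last t).castSucc, p.2 (Fin.last t), p.1 (Fin.last (t + 1))))
          (measurable_lastStep t))).map
      (fun p => (Fin.snoc p.1 p.2 : Path 𝒳 (t + 1)))

/-- The joint law of the pair of trajectories `((X_0, …, X_t), (Y_0, …, Y_t))` produced by one
execution of the routine: the backward phase from `X_t = ⊥`, then the forward phase. -/
def routineLaw {𝒳 : Type*} [MeasurableSpace 𝒳] [PartialOrder 𝒳] [BoundedOrder 𝒳]
    (K' : Kernel 𝒳 𝒳) (M : Kernel (𝒳 × 𝒳 × 𝒳) 𝒳) (t : ℕ) : Measure (Path 𝒳 t × Path 𝒳 t) :=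
  (backward K' t ⊥).compProd (forward M t)

end

instance backward_isMarkov {𝒳 : Type*} [MeasurableSpace 𝒳] (K' : Kernel 𝒳 𝒳)
    [IsMarkovKernel K'] : (t : ℕ) → IsMarkovKernel (backward K' t)
  | 0 => by unfold backward; infer_instance
  | t + 1 => by
      have := backward_isMarkov K' t
      unfold backward
      exact Kernel.IsMarkovKernel.map _ (measurable_snoc t)

instance forward_isMarkov {𝒳 : Type*} [MeasurableSpace 𝒳] [PartialOrder 𝒳] [BoundedOrder 𝒳]
    (M : Kernel (𝒳 × 𝒳 × 𝒳) 𝒳) [IsMarkovKernel M] : (t : ℕ) → IsMarkovKernel (forward M t)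
  | 0 => by unfold forward; infer_instance
  | t + 1 => by
      have := forward_isMarkov M t
      unfold forward
      exact Kernel.IsMarkovKernel.map _ (measurable_snoc t)

instance routineLaw_isProbability {𝒳 : Type*} [MeasurableSpace 𝒳] [PartialOrder 𝒳]
    [BoundedOrder 𝒳] (K' : Kernel 𝒳 𝒳) [IsMarkovKernel K'] (M : Kernel (𝒳 × 𝒳 × 𝒳) 𝒳)
    [IsMarkovKernel M] (t : ℕ) : IsProbabilityMeasure (routineLaw K' M t) := by
  unfold routineLaw; infer_instance

end PerfectSampling

/-! Start the backward phase from `X_t ∼ π` instead of `⊥`. By time-reversal the trajectory of `X`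
is then a stationary forward `K`-chain, so `X_0 ∼ π`. The chain `Y` starts at `⊤` and stays above
`X`; averaging `M` over the step of `X` leaves a `K`-step of `Y`, so the law `ν` of `Y_t` given
`X_0` is that of a `K`-chain from `⊤`, whatever `X_0` is. Hence `X_0` and `Y_t` are independent
(`exists_lintegral_endpointLaw_eq`). Since `X_t ≤ Y_t` (`ae_endpointLaw_le`), acceptance forces `X_t
= ⊥`. Disintegrating over `X_t`, which has an atom at `⊥`, shows that the routine from `⊥` accepts
with `X_0 ∈ A` with probability `π A * ν {⊥} / π {⊥}`, proportional to `π A`. Repetition until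
acceptance is then ordinary rejection sampling. -/

namespace PerfectSampling

/-! ### Integration against the backward and forward phases -/

section Routine

variable {𝒳 : Type*} [MeasurableSpace 𝒳]

theorem lintegral_backward_succ (K' : Kernel 𝒳 𝒳) [IsMarkovKernel K'] (t : ℕ) (z : 𝒳)
    {f : Path 𝒳 (t + 1) → ENNReal} (hf : Measurable f) :
    ∫⁻ x, f x ∂backward K' (t + 1) z =
      ∫⁻ z₁, ∫⁻ x, f (Fin.snoc x z : Path 𝒳 (t + 1)) ∂backward K' t z₁ ∂K' z := by
  have hm := hf.comp (measurable_snoc (𝒳 := 𝒳) t)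
  simp only [Function.comp_def] at hm
  rw [backward, Kernel.lintegral_map _ (measurable_snoc t) _ hf, Kernel.lintegral_prod _ _ _ hm]
  have h1 : ∀ x : Path 𝒳 t, ∫⁻ c, f (Fin.snoc x c : Path 𝒳 (t + 1)) ∂Kernel.id z =
      f (Fin.snoc x z : Path 𝒳 (t + 1)) := fun x => by
    rw [Kernel.id_apply]
    exact lintegral_dirac' _ (hm.comp measurable_prodMk_left)
  simp only [h1]
  exact Kernel.lintegral_comp _ _ _ (hm.comp measurable_prodMk_right)

/-- The trajectory ends at its starting state `z`. This lets the time-`t` coordinate read by the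
next forward step be exchanged for the state `z₁` integrated against `K'`. -/
theorem lintegral_backward_last (K' : Kernel 𝒳 𝒳) [IsMarkovKernel K'] (t : ℕ) (z : 𝒳)
    {f : 𝒳 × Path 𝒳 t → ENNReal} (hf : Measurable f) :
    ∫⁻ x, f (x (Fin.last t), x) ∂backward K' t z = ∫⁻ x, f (z, x) ∂backward K' t z := by
  cases t with
  | zero =>
    rw [backward, Kernel.lintegral_deterministic' _ (by fun_prop),
      Kernel.lintegral_deterministic' _ (by fun_prop)]
  | succ t =>
    rw [lintegral_backward_succ _ _ _ (by fun_prop), lintegral_backward_succ _ _ _ (by fun_prop)]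
    simp only [Fin.snoc_last]

theorem IsTimeReversal.lintegral_lintegral {K K' : Kernel 𝒳 𝒳}
    [IsMarkovKernel K] [IsMarkovKernel K'] {π : Measure 𝒳} [IsProbabilityMeasure π]
    (h : IsTimeReversal π K K') {f : 𝒳 × 𝒳 → ENNReal}
    (hf : Measurable f) :
    ∫⁻ z, ∫⁻ z₁, f (z₁, z) ∂K' z ∂π = ∫⁻ z₁, ∫⁻ z, f (z₁, z) ∂K z₁ ∂π := by
  rw [← Measure.lintegral_compProd (f := fun p => f (p.2, p.1)) (by fun_prop),
    ← Measure.lintegral_compProd hf, h, lintegral_map hf measurable_swap]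
  rfl

variable [PartialOrder 𝒳] [BoundedOrder 𝒳]

theorem lintegral_forward_succ (M : Kernel (𝒳 × 𝒳 × 𝒳) 𝒳) [IsMarkovKernel M] (t : ℕ)
    (x : Path 𝒳 (t + 1)) {f : Path 𝒳 (t + 1) → ENNReal} (hf : Measurable f) :
    ∫⁻ y, f y ∂forward M (t + 1) x =
      ∫⁻ y, ∫⁻ y', f (Fin.snoc y y' : Path 𝒳 (t + 1))
        ∂M (x (Fin.last t).castSucc, y (Fin.last t), x (Fin.last (t + 1)))
        ∂forward M t (Fin.init x) := by
  have hm := hf.comp (measurable_snoc (𝒳 := 𝒳) t)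
  simp only [Function.comp_def] at hm
  rw [forward, Kernel.lintegral_map _ (measurable_snoc t) _ hf,
    Kernel.lintegral_compProd _ _ _ hm]
  simp only [Kernel.comap_apply]

/-! ### The triple `(X_t, X_0, Y_t)` -/

noncomputable section

/-- The law of `(X_0, Y_t)` when the backward phase starts from `X_t = z`. -/
def endpointKernel (K' : Kernel 𝒳 𝒳) (M : Kernel (𝒳 × 𝒳 × 𝒳) 𝒳) (t : ℕ) :
    Kernel 𝒳 (𝒳 × 𝒳) :=
  ((backward K' t).compProd ((forward M t).comap Prod.snd measurable_snd)).map
    (fun p => (p.1 0, p.2 (Fin.last t)))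

/-- The law of `(X_t, (X_0, Y_t))` when the backward phase starts from `X_t ∼ π`. -/
def endpointLaw (π : Measure 𝒳) (K' : Kernel 𝒳 𝒳) (M : Kernel (𝒳 × 𝒳 × 𝒳) 𝒳) (t : ℕ) :
    Measure (𝒳 × 𝒳 × 𝒳) :=
  π.compProd (endpointKernel K' M t)

end

instance endpointKernel_isMarkov (K' : Kernel 𝒳 𝒳) [IsMarkovKernel K']
    (M : Kernel (𝒳 × 𝒳 × 𝒳) 𝒳) [IsMarkovKernel M] (t : ℕ) :
    IsMarkovKernel (endpointKernel K' M t) := by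
  unfold endpointKernel
  exact Kernel.IsMarkovKernel.map _ (by fun_prop)

variable (K K' : Kernel 𝒳 𝒳) [IsMarkovKernel K] [IsMarkovKernel K']
  (M : Kernel (𝒳 × 𝒳 × 𝒳) 𝒳) [IsMarkovKernel M]

theorem lintegral_endpointKernel (t : ℕ) (z : 𝒳) {f : 𝒳 × 𝒳 → ENNReal} (hf : Measurable f) :
    ∫⁻ p, f p ∂endpointKernel K' M t z =
      ∫⁻ x, ∫⁻ y, f (x 0, y (Fin.last t)) ∂forward M t x ∂backward K' t z := by
  rw [endpointKernel, Kernel.lintegral_map _ (by fun_prop) _ hf,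
    Kernel.lintegral_compProd _ _ _ (by fun_prop)]
  simp only [Kernel.comap_apply]

theorem endpointKernel_apply (t : ℕ) (z : 𝒳) {S : Set (𝒳 × 𝒳)} (hS : MeasurableSet S) :
    endpointKernel K' M t z S = ((backward K' t z).compProd (forward M t))
      {p | (p.1 0, p.2 (Fin.last t)) ∈ S} := by
  have hm : Measurable fun p : Path 𝒳 t × Path 𝒳 t => (p.1 0, p.2 (Fin.last t)) := by fun_prop
  have hT : MeasurableSet {p : Path 𝒳 t × Path 𝒳 t | (p.1 0, p.2 (Fin.last t)) ∈ S} := hm hS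
  rw [← lintegral_indicator_one hS, lintegral_endpointKernel K' M t z (measurable_one.indicator hS),
    ← lintegral_indicator_one hT,
    Measure.lintegral_compProd (measurable_one.indicator hT)]
  rfl

theorem lintegral_endpointKernel_zero (z : 𝒳) {f : 𝒳 × 𝒳 → ENNReal} (hf : Measurable f) :
    ∫⁻ p, f p ∂endpointKernel K' M 0 z = f (z, ⊤) := by
  rw [lintegral_endpointKernel K' M 0 z hf, backward, forward]
  simp only [Kernel.const_apply]
  rw [Kernel.lintegral_deterministic' _ (by fun_prop), lintegral_dirac' _ (by fun_prop)]

theorem lintegral_endpointKernel_succ (t : ℕ) (z : 𝒳) {f : 𝒳 × 𝒳 → ENNReal}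
    (hf : Measurable f) :
    ∫⁻ p, f p ∂endpointKernel K' M (t + 1) z =
      ∫⁻ z₁, ∫⁻ p, ∫⁻ y', f (p.1, y') ∂M (z₁, p.2, z) ∂endpointKernel K' M t z₁ ∂K' z := by
  rw [lintegral_endpointKernel K' M (t + 1) z hf, lintegral_backward_succ _ _ _ (by fun_prop)]
  refine lintegral_congr fun z₁ => ?_
  have hg : Measurable fun q : 𝒳 × 𝒳 × 𝒳 => ∫⁻ y', f (q.2.1, y') ∂M (q.1, q.2.2, z) := by
    have := Measurable.lintegral_kernel_prod_right (κ := M.comap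
      (fun q : 𝒳 × 𝒳 × 𝒳 => (q.1, q.2.2, z)) (by fun_prop)) (f := fun q y' => f (q.2.1, y'))
      (by fun_prop)
    simpa only [Kernel.comap_apply] using this
  rw [lintegral_endpointKernel K' M t z₁
    (f := fun p => ∫⁻ y', f (p.1, y') ∂M (z₁, p.2, z))
    (hg.comp (f := fun p : 𝒳 × 𝒳 => (z₁, p)) (by fun_prop))]
  have hG : Measurable fun q : 𝒳 × Path 𝒳 t =>
      ∫⁻ y, ∫⁻ y', f (q.2 0, y') ∂M (q.1, y (Fin.last t), z) ∂forward M t q.2 := by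
    have := Measurable.lintegral_kernel_prod_right (κ := (forward M t).comap
      (fun q : 𝒳 × Path 𝒳 t => q.2) (by fun_prop))
      (f := fun q y => ∫⁻ y', f (q.2 0, y') ∂M (q.1, y (Fin.last t), z))
      (hg.comp (f := fun r : (𝒳 × Path 𝒳 t) × Path 𝒳 t =>
        (r.1.1, r.1.2 0, r.2 (Fin.last t))) (by fun_prop))
    simpa only [Kernel.comap_apply] using this
  rw [← lintegral_backward_last K' t z₁ hG]
  refine lintegral_congr fun x => ?_
  rw [lintegral_forward_succ M t _ (by fun_prop)]
  have h0 : (Fin.snoc x z : Path 𝒳 (t + 1)) 0 = x 0 := Fin.snoc_castSucc (α := fun _ => 𝒳) z x 0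
  simp only [Fin.snoc_last, Fin.snoc_castSucc, Fin.init_snoc, h0]

variable {K K'} {π : Measure 𝒳} [IsProbabilityMeasure π]

variable {M}

/-- Under `π`, reversal turns the extra backward step `K' z` into a forward step `K z₁`. So the
triple is a Markov chain in `t`: `X_t` moves by `K`, `Y_t` by `M`, and `X_0` is carried along. -/
theorem lintegral_endpointLaw_succ (h : IsTimeReversal π K K') (t : ℕ)
    {f : 𝒳 × 𝒳 × 𝒳 → ENNReal} (hf : Measurable f) :
    ∫⁻ q, f q ∂endpointLaw π K' M (t + 1) =
      ∫⁻ q, ∫⁻ z, ∫⁻ y', f (z, q.2.1, y') ∂M (q.1, q.2.2, z) ∂K q.1 ∂endpointLaw π K' M t := by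
  have h3 : Measurable fun r : (𝒳 × 𝒳 × 𝒳) × 𝒳 =>
      ∫⁻ y', f (r.2, r.1.2.1, y') ∂M (r.1.1, r.1.2.2, r.2) := by
    have := Measurable.lintegral_kernel_prod_right (κ := M.comap
      (fun r : (𝒳 × 𝒳 × 𝒳) × 𝒳 => (r.1.1, r.1.2.2, r.2)) (by fun_prop))
      (f := fun r y' => f (r.2, r.1.2.1, y')) (by fun_prop)
    simpa only [Kernel.comap_apply] using this
  have h2 : Measurable fun q : 𝒳 × 𝒳 × 𝒳 =>
      ∫⁻ z, ∫⁻ y', f (z, q.2.1, y') ∂M (q.1, q.2.2, z) ∂K q.1 := by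
    have := Measurable.lintegral_kernel_prod_right (κ := K.comap
      (fun q : 𝒳 × 𝒳 × 𝒳 => q.1) (by fun_prop))
      (f := fun q z => ∫⁻ y', f (z, q.2.1, y') ∂M (q.1, q.2.2, z)) h3
    simpa only [Kernel.comap_apply] using this
  have h1 : Measurable fun r : 𝒳 × 𝒳 =>
      ∫⁻ p, ∫⁻ y', f (r.2, p.1, y') ∂M (r.1, p.2, r.2) ∂endpointKernel K' M t r.1 := by
    have := Measurable.lintegral_kernel_prod_right (κ := (endpointKernel K' M t).comap
      (fun r : 𝒳 × 𝒳 => r.1) (by fun_prop))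
      (f := fun r p => ∫⁻ y', f (r.2, p.1, y') ∂M (r.1, p.2, r.2))
      (h3.comp (f := fun s : (𝒳 × 𝒳) × 𝒳 × 𝒳 => ((s.1.1, s.2), s.1.2)) (by fun_prop))
    simpa only [Kernel.comap_apply] using this
  rw [endpointLaw, Measure.lintegral_compProd hf, endpointLaw, Measure.lintegral_compProd h2]
  calc ∫⁻ z, ∫⁻ p, f (z, p) ∂endpointKernel K' M (t + 1) z ∂π
      = ∫⁻ z, ∫⁻ z₁, ∫⁻ p, ∫⁻ y', f (z, p.1, y') ∂M (z₁, p.2, z)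
          ∂endpointKernel K' M t z₁ ∂K' z ∂π := lintegral_congr fun z =>
        lintegral_endpointKernel_succ K' M t z (f := fun p => f (z, p)) (by fun_prop)
    _ = ∫⁻ z₁, ∫⁻ z, ∫⁻ p, ∫⁻ y', f (z, p.1, y') ∂M (z₁, p.2, z)
          ∂endpointKernel K' M t z₁ ∂K z₁ ∂π := h.lintegral_lintegral h1
    _ = _ := by
        -- Given `z₁`, the new state `z` is independent of `(X_0, Y_t)`.
        refine lintegral_congr fun z₁ => lintegral_lintegral_swap ?_
        exact (h3.comp (f := fun s : 𝒳 × 𝒳 × 𝒳 => ((z₁, s.2), s.1)) (by fun_prop)).aemeasurable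

theorem lintegral_endpointLaw_zero {f : 𝒳 × 𝒳 × 𝒳 → ENNReal} (hf : Measurable f) :
    ∫⁻ q, f q ∂endpointLaw π K' M 0 = ∫⁻ z, f (z, z, ⊤) ∂π := by
  rw [endpointLaw, Measure.lintegral_compProd hf]
  exact lintegral_congr fun z =>
    lintegral_endpointKernel_zero K' M z (f := fun p => f (z, p)) (by fun_prop)

/-! ### Domination, independence and acceptance -/

theorem ae_endpointLaw_le (hle : MeasurableSet {p : 𝒳 × 𝒳 | p.1 ≤ p.2})
    (h : IsTimeReversal π K K') (hM : IsUpwardFamily K M) (t : ℕ) :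
    ∀ᵐ q ∂endpointLaw π K' M t, q.1 ≤ q.2.2 := by
  have hS : MeasurableSet {q : 𝒳 × 𝒳 × 𝒳 | ¬ q.1 ≤ q.2.2} :=
    (hle.preimage (f := fun q : 𝒳 × 𝒳 × 𝒳 => (q.1, q.2.2)) (by fun_prop)).compl
  induction t with
  | zero =>
    rw [ae_iff, ← lintegral_indicator_one hS,
      lintegral_endpointLaw_zero (measurable_one.indicator hS)]
    simp
  | succ t ih =>
    rw [ae_iff, ← lintegral_indicator_one hS,
      lintegral_endpointLaw_succ h t (measurable_one.indicator hS), ← lintegral_zero]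
    refine lintegral_congr_ae ?_
    filter_upwards [ih] with q hq
    rw [← lintegral_zero (μ := K q.1)]
    refine lintegral_congr fun z => ?_
    rw [← (hM q.1 q.2.2 hq).1 z, ← lintegral_indicator_one₀]
    · rfl
    · exact NullMeasurableSet.of_null ((hM q.1 q.2.2 hq).1 z)

theorem exists_lintegral_endpointLaw_eq (hle : MeasurableSet {p : 𝒳 × 𝒳 | p.1 ≤ p.2})
    (h : IsTimeReversal π K K') (hM : IsUpwardFamily K M) (t : ℕ) :
    ∃ ν : Measure 𝒳, ∀ A : Set 𝒳, MeasurableSet A → ∀ g : 𝒳 → ENNReal, Measurable g →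
      ∫⁻ q, A.indicator 1 q.2.1 * g q.2.2 ∂endpointLaw π K' M t = π A * ∫⁻ y, g y ∂ν := by
  induction t with
  | zero =>
    refine ⟨Measure.dirac ⊤, fun A hA g hg => ?_⟩
    have hi : Measurable (A.indicator (1 : 𝒳 → ENNReal)) := measurable_one.indicator hA
    rw [lintegral_endpointLaw_zero (by fun_prop), lintegral_dirac' _ hg]
    dsimp only
    rw [lintegral_mul_const _ hi, lintegral_indicator_one hA]
  | succ t ih =>
    obtain ⟨ν, hν⟩ := ih
    -- The measure after `t` steps is the law at time `t` of a `K`-chain from `⊤`.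
    refine ⟨ν.bind K, fun A hA g hg => ?_⟩
    have hi : Measurable (A.indicator (1 : 𝒳 → ENNReal)) := measurable_one.indicator hA
    rw [lintegral_endpointLaw_succ h t (by fun_prop),
      Measure.lintegral_bind K.measurable.aemeasurable hg.aemeasurable,
      ← hν A hA _ hg.lintegral_kernel]
    refine lintegral_congr_ae ?_
    -- The averaging identity for `M` needs `X_t ≤ Y_t`, which holds almost surely; it removes all
    -- dependence on `q.1`.
    filter_upwards [ae_endpointLaw_le hle h hM t] with q hq
    have hMm : Measurable fun z => M (q.1, q.2.2, z) := M.measurable.comp (by fun_prop)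
    have hgm : Measurable fun z => ∫⁻ y', g y' ∂M (q.1, q.2.2, z) :=
      (Measure.measurable_lintegral hg).comp hMm
    simp only [lintegral_const_mul _ hg]
    rw [lintegral_const_mul _ hgm, (hM q.1 q.2.2 hq).2,
      Measure.lintegral_bind hMm.aemeasurable hg.aemeasurable]

theorem exists_routineLaw_accept_eq [MeasurableSingletonClass 𝒳]
    (hle : MeasurableSet {p : 𝒳 × 𝒳 | p.1 ≤ p.2}) (hπ : π {⊥} ≠ 0)
    (h : IsTimeReversal π K K') (hM : IsUpwardFamily K M) (t : ℕ) :
    ∃ c : ENNReal, ∀ A : Set 𝒳, MeasurableSet A →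
      routineLaw K' M t {p | p.1 0 ∈ A ∧ p.2 (Fin.last t) = ⊥} = π A * c := by
  obtain ⟨ν, hν⟩ := exists_lintegral_endpointLaw_eq hle h hM t
  refine ⟨ν {⊥} / π {⊥}, fun A hA => ?_⟩
  have hS : MeasurableSet (A ×ˢ ({⊥} : Set 𝒳)) := hA.prod (measurableSet_singleton _)
  -- The event `X_t = ⊥`, `X_0 ∈ A`, `Y_t = ⊥` is measured twice: by disintegrating over `X_t`, then
  -- by independence.
  have h1 : endpointLaw π K' M t ({⊥} ×ˢ (A ×ˢ {⊥})) =
      π {⊥} * routineLaw K' M t {p | p.1 0 ∈ A ∧ p.2 (Fin.last t) = ⊥} := by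
    rw [endpointLaw, Measure.compProd_apply_prod (measurableSet_singleton _) hS,
      lintegral_singleton, endpointKernel_apply K' M t ⊥ hS, mul_comm]
    rfl
  have h2 : endpointLaw π K' M t ({⊥} ×ˢ (A ×ˢ {⊥})) = π A * ν {⊥} := by
    rw [← lintegral_indicator_one (measurableSet_singleton _ |>.prod hS),
      ← lintegral_indicator_one (μ := ν) (measurableSet_singleton _),
      ← hν A hA _ (measurable_one.indicator (measurableSet_singleton _))]
    refine lintegral_congr_ae ?_
    filter_upwards [ae_endpointLaw_le hle h hM t] with q hq
    by_cases h3 : q.2.2 = ⊥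
    -- Domination makes the constraint `X_t = ⊥` redundant.
    · have h4 : q.1 = ⊥ := le_bot_iff.1 (h3 ▸ hq)
      by_cases h5 : q.2.1 ∈ A <;> simp [Set.indicator, h3, h4, h5]
    · simp [Set.indicator, h3]
  rw [← mul_div_assoc, ← h2, h1, mul_comm,
    ENNReal.mul_div_cancel_right hπ (measure_ne_top _ _)]

theorem cond_routineLaw_map_eq [MeasurableSingletonClass 𝒳]
    (hle : MeasurableSet {p : 𝒳 × 𝒳 | p.1 ≤ p.2}) (hπ : π {⊥} ≠ 0)
    (h : IsTimeReversal π K K') (hM : IsUpwardFamily K M) (t : ℕ)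
    (hC : routineLaw K' M t {p | p.2 (Fin.last t) = ⊥} ≠ 0) :
    (cond (routineLaw K' M t) {p | p.2 (Fin.last t) = ⊥}).map (fun p => p.1 0) = π := by
  obtain ⟨c, hc⟩ := exists_routineLaw_accept_eq hle hπ h hM t
  have hS : MeasurableSet {p : Path 𝒳 t × Path 𝒳 t | p.2 (Fin.last t) = ⊥} :=
    (measurableSet_singleton (⊥ : 𝒳)).preimage
      (f := fun p : Path 𝒳 t × Path 𝒳 t => p.2 (Fin.last t)) (by fun_prop)
  have h1 : routineLaw K' M t {p | p.2 (Fin.last t) = ⊥} = c := by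
    simpa using hc Set.univ .univ
  ext A hA
  rw [Measure.map_apply (by fun_prop) hA, cond_apply hS, h1, Set.inter_comm]
  have h2 := hc A hA
  rw [h1] at hC
  have hc' : c ≠ ⊤ := h1 ▸ measure_ne_top _ _
  change c⁻¹ * routineLaw K' M t {p | p.1 0 ∈ A ∧ p.2 (Fin.last t) = ⊥} = π A
  rw [h2, mul_comm, mul_assoc, ENNReal.mul_inv_cancel hC hc', mul_one]

end Routine

/-! ### Rejection sampling -/

section Rejection

variable {Ω E : Type*} [MeasurableSpace Ω] [MeasurableSpace E] {P : Measure Ω} {μ : Measure E}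
  {S : Set E}

theorem hasLaw_cond_of_hasLaw {Z : Ω → E} (hZ : HasLaw Z μ P) (hS : MeasurableSet S) :
    HasLaw Z (cond μ S) (cond P (Z ⁻¹' S)) where
  aemeasurable := hZ.aemeasurable.mono_ac cond_absolutelyContinuous
  map_eq := by
    have h1 : P (Z ⁻¹' S) = μ S := by
      rw [← hZ.map_eq, Measure.map_apply_of_aemeasurable hZ.aemeasurable hS]
    ext B hB
    rw [Measure.map_apply_of_aemeasurable
        (hZ.aemeasurable.mono_ac cond_absolutelyContinuous) hB, cond_apply hS, ProbabilityTheory.cond, h1,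
      Measure.smul_apply, smul_eq_mul, Measure.restrict_apply₀ ?_, ← Set.preimage_inter,
      Set.inter_comm B, ← hZ.map_eq,
      Measure.map_apply_of_aemeasurable hZ.aemeasurable (hS.inter hB)]
    exact (hZ.aemeasurable.nullMeasurable hB).mono_ac Measure.restrict_le_self.absolutelyContinuous

variable [IsProbabilityMeasure P]

theorem measure_first_hit_eq {Z : ℕ → Ω → E} (hZm : ∀ n, Measurable (Z n)) (hind : iIndepFun Z P)
    (hZ : ∀ n, HasLaw (Z n) μ P) (hS : MeasurableSet S) {B : Set E} (hB : MeasurableSet B)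
    (n : ℕ) :
    P {ω | Z n ω ∈ S ∩ B ∧ ∀ m < n, Z m ω ∉ S} = (1 - μ S) ^ n * μ (S ∩ B) := by
  have : IsProbabilityMeasure μ := (hZ 0).isProbabilityMeasure_iff.1 inferInstance
  have hm : ∀ (k : ℕ) {C : Set E}, MeasurableSet C → P (Z k ⁻¹' C) = μ C := fun k C hC => by
    rw [← (hZ k).map_eq, Measure.map_apply (hZm k) hC]
  -- The event prescribes misses at times `0, …, n - 1` and a hit in `S ∩ B` at time `n`.
  have h := hind.measure_inter_preimage_eq_mul (Finset.range (n + 1))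
    (sets := fun k => if k = n then S ∩ B else Sᶜ) (fun k _ => by
      split_ifs
      exacts [hS.inter hB, hS.compl])
  rw [Finset.prod_range_succ, if_pos rfl, hm n (hS.inter hB), Finset.prod_congr rfl
    (g := fun _ => 1 - μ S), Finset.prod_const, Finset.card_range] at h
  · rw [← h]
    congr 1
    ext ω
    simp only [Set.mem_ofPred_eq, Set.mem_iInter, Finset.mem_range, Set.mem_preimage]
    constructor
    · rintro ⟨h1, h2⟩ k hk
      rcases eq_or_ne k n with rfl | hkn
      · simpa using h1
      · simpa [hkn] using h2 k (by omega)
    · intro h3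
      refine ⟨by simpa using h3 n (by omega), fun k hk => ?_⟩
      simpa [hk.ne] using h3 k (by omega)
  · intro k hk
    rw [if_neg (Finset.mem_range.1 hk).ne, hm k hS.compl, prob_compl_eq_one_sub hS]

theorem measurable_first_hit {Z : ℕ → Ω → E} (hZm : ∀ n, Measurable (Z n))
    (hS : MeasurableSet S) : Measurable fun ω => sInf {n | Z n ω ∈ S} := by
  have hA : ∀ n, MeasurableSet {ω | Z n ω ∈ S} := fun n => hZm n hS
  refine measurable_to_countable' fun n => ?_
  -- As `sInf ∅ = 0` in `ℕ`, the fibre over `0` also contains the outcomes that never hit `S`.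
  have h : (fun ω => sInf {n | Z n ω ∈ S}) ⁻¹' {n} =
      {ω | (Z n ω ∈ S ∧ ∀ m < n, ¬ Z m ω ∈ S) ∨ (n = 0 ∧ ∀ m, ¬ Z m ω ∈ S)} := by
    ext ω
    simp only [Set.mem_preimage, Set.mem_singleton_iff, Set.mem_ofPred_eq]
    constructor
    · rintro rfl
      by_cases hne : {n | Z n ω ∈ S}.Nonempty
      · exact .inl ⟨Nat.sInf_mem hne, fun m hm => Nat.notMem_of_lt_sInf hm⟩
      · rw [Set.not_nonempty_iff_eq_empty] at hne
        exact .inr ⟨by simp [hne], fun m => Set.eq_empty_iff_forall_notMem.1 hne m⟩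
    · rintro (⟨h1, h2⟩ | ⟨rfl, h2⟩)
      · exact IsLeast.csInf_eq ⟨h1, fun m hm => not_lt.1 fun hlt => h2 m hlt hm⟩
      · have : {n | Z n ω ∈ S} = ∅ := Set.eq_empty_iff_forall_notMem.2 h2
        simp [this]
  rw [h]
  measurability

theorem rejection_sampling_of_measurable {Z : ℕ → Ω → E} (hZm : ∀ n, Measurable (Z n))
    (hind : iIndepFun Z P) (hZ : ∀ n, HasLaw (Z n) μ P) (hS : MeasurableSet S) (hμS : μ S ≠ 0) :
    (∀ᵐ ω ∂P, ∃ n, Z n ω ∈ S) ∧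
      HasLaw (fun ω => Z (sInf {n | Z n ω ∈ S}) ω) (cond μ S) P := by
  have : IsProbabilityMeasure μ := (hZ 0).isProbabilityMeasure_iff.1 inferInstance
  have hDm : ∀ {B : Set E}, MeasurableSet B → ∀ n,
      MeasurableSet {ω | Z n ω ∈ S ∩ B ∧ ∀ m < n, Z m ω ∉ S} := fun {B} hB n => by
    have h1 : MeasurableSet {ω | Z n ω ∈ S ∩ B} := hZm n (hS.inter hB)
    have h2 : ∀ m, MeasurableSet {ω | Z m ω ∉ S} := fun m => (hZm m hS).compl
    measurability
  -- A geometric series of ratio `1 - μ S`; taking `B` to be everything gives total mass `1`, hence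
  -- an almost sure hit.
  have hsum : ∀ {B : Set E}, MeasurableSet B →
      P (⋃ n, {ω | Z n ω ∈ S ∩ B ∧ ∀ m < n, Z m ω ∉ S}) = (μ S)⁻¹ * μ (S ∩ B) := fun {B} hB => by
    rw [measure_iUnion _ (hDm hB)]
    · simp only [measure_first_hit_eq hZm hind hZ hS hB]
      rw [ENNReal.tsum_mul_right, ENNReal.tsum_geometric,
        ENNReal.sub_sub_cancel ENNReal.one_ne_top prob_le_one]
    · intro i j hij
      refine Set.disjoint_left.2 fun ω hi hj => ?_
      rcases lt_or_gt_of_ne hij with hlt | hlt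
      · exact hj.2 i hlt hi.1.1
      · exact hi.2 j hlt hj.1.1
  have hex : ∀ᵐ ω ∂P, ∃ n, Z n ω ∈ S := by
    have h1 := hsum (B := Set.univ) .univ
    rw [Set.inter_univ, ENNReal.inv_mul_cancel hμS (measure_ne_top _ _)] at h1
    have h2 := (prob_compl_eq_zero_iff (.iUnion (hDm .univ))).2 (by simpa using h1)
    filter_upwards [compl_mem_ae_iff.2 h2] with ω hω
    simp only [compl_compl, Set.mem_iUnion] at hω
    obtain ⟨n, hn⟩ := hω
    exact ⟨n, hn.1.1⟩
  have hT : Measurable fun ω => Z (sInf {n | Z n ω ∈ S}) ω :=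
    (measurable_from_prod_countable_right (f := fun p : ℕ × Ω => Z p.1 p.2) hZm).comp
      ((measurable_first_hit hZm hS).prodMk measurable_id)
  refine ⟨hex, hT.aemeasurable, ?_⟩
  ext B hB
  rw [Measure.map_apply hT hB, cond_apply hS, ← hsum hB]
  refine measure_congr ?_
  filter_upwards [hex] with ω hω
  refine propext ?_
  change Z (sInf {n | Z n ω ∈ S}) ω ∈ B ↔ ω ∈ ⋃ n, {ω | Z n ω ∈ S ∩ B ∧ ∀ m < n, Z m ω ∉ S}
  simp only [Set.mem_iUnion, Set.mem_ofPred_eq]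
  constructor
  · exact fun hb => ⟨_, ⟨Nat.sInf_mem hω, hb⟩, fun m hm => Nat.notMem_of_lt_sInf hm⟩
  · rintro ⟨n, ⟨h1, h2⟩, h3⟩
    rwa [IsLeast.csInf_eq (s := {n | Z n ω ∈ S})
      ⟨h1, fun m hm => not_lt.1 fun hlt => h3 m hlt hm⟩]

/-- Rejection sampling: among i.i.d. variables of law `μ`, some variable falls in `S` almost
surely, and the first one that does has law `μ` conditioned on `S`. -/
theorem rejection_sampling {Z : ℕ → Ω → E} (hind : iIndepFun Z P)
    (hZ : ∀ n, HasLaw (Z n) μ P) (hS : MeasurableSet S) (hμS : μ S ≠ 0) :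
    (∀ᵐ ω ∂P, ∃ n, Z n ω ∈ S) ∧
      HasLaw (fun ω => Z (sInf {n | Z n ω ∈ S}) ω) (cond μ S) P := by
  -- `HasLaw` gives only a.e.-measurability, so the `Z n` are replaced by measurable versions, equal
  -- for all `n` at once almost surely.
  have hae := fun n => (hZ n).aemeasurable.ae_eq_mk
  have h := rejection_sampling_of_measurable (fun n => (hZ n).aemeasurable.measurable_mk)
    (hind.congr hae) (fun n => (hZ n).congr (hae n).symm) hS hμS
  have hall : ∀ᵐ ω ∂P, ∀ n, Z n ω = (hZ n).aemeasurable.mk (Z n) ω := ae_all_iff.2 hae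
  refine ⟨?_, h.2.congr ?_⟩
  · filter_upwards [h.1, hall] with ω h1 h2
    simpa only [h2] using h1
  · filter_upwards [hall] with ω h2
    simp only [h2]

end Rejection

end PerfectSampling

theorem mainTheorem3 {𝒳 : Type*} [TopologicalSpace 𝒳] [PolishSpace 𝒳] [MeasurableSpace 𝒳]
    [BorelSpace 𝒳] [PartialOrder 𝒳] [OrderClosedTopology 𝒳] [BoundedOrder 𝒳]
    (π : Measure 𝒳) [IsProbabilityMeasure π] (hπ : 0 < π {⊥})
    (K K' : Kernel 𝒳 𝒳) [IsMarkovKernel K] [IsMarkovKernel K']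
    (hK : K.Invariant π) (hmono : PerfectSampling.StochMonotone K)
    (hK' : PerfectSampling.IsTimeReversal π K K')
    (M : Kernel (𝒳 × 𝒳 × 𝒳) 𝒳) [IsMarkovKernel M] (hM : PerfectSampling.IsUpwardFamily K M)
    (t : ℕ) (ht : 0 < t)
    (hC : 0 < PerfectSampling.routineLaw K' M t {p | p.2 (Fin.last t) = ⊥}) :
    -- one execution of the routine, conditioned on acceptance
    (∀ (Ω : Type*) [MeasurableSpace Ω] (P : Measure Ω) [IsProbabilityMeasure P]
        (X Y : Ω → PerfectSampling.Path 𝒳 t),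
        HasLaw (fun ω => (X ω, Y ω)) (PerfectSampling.routineLaw K' M t) P →
        HasLaw (fun ω => X ω 0) π (cond P {ω | Y ω (Fin.last t) = ⊥})) ∧
    -- independent repetitions of the routine until the first acceptance
    (∀ (Ω : Type*) [MeasurableSpace Ω] (P : Measure Ω) [IsProbabilityMeasure P]
        (X Y : ℕ → Ω → PerfectSampling.Path 𝒳 t),
        iIndepFun (fun n ω => (X n ω, Y n ω)) P →
        (∀ n, HasLaw (fun ω => (X n ω, Y n ω)) (PerfectSampling.routineLaw K' M t) P) →
        (∀ᵐ ω ∂P, ∃ n, Y n ω (Fin.last t) = ⊥) ∧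
        HasLaw (fun ω => X (sInf {n | Y n ω (Fin.last t) = ⊥}) ω 0) π P) := by
  have hle : MeasurableSet {p : 𝒳 × 𝒳 | p.1 ≤ p.2} := measurableSet_le measurable_fst measurable_snd
  have hmap := PerfectSampling.cond_routineLaw_map_eq hle hπ.ne' hK' hM t hC.ne'
  have hS : MeasurableSet {p : PerfectSampling.Path 𝒳 t × PerfectSampling.Path 𝒳 t |
      p.2 (Fin.last t) = ⊥} :=
    (measurableSet_singleton (⊥ : 𝒳)).preimage
      (f := fun p : PerfectSampling.Path 𝒳 t × PerfectSampling.Path 𝒳 t => p.2 (Fin.last t))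
      (by fun_prop)
  have hproj : HasLaw (fun p : PerfectSampling.Path 𝒳 t × PerfectSampling.Path 𝒳 t => p.1 0) π
      (cond (PerfectSampling.routineLaw K' M t) {p | p.2 (Fin.last t) = ⊥}) :=
    ⟨by fun_prop, hmap⟩
  refine ⟨fun Ω _ P _ X Y hXY => ?_, fun Ω _ P _ X Y hind hXY => ?_⟩
  · exact hproj.fun_comp (PerfectSampling.hasLaw_cond_of_hasLaw hXY hS)
  · obtain ⟨h1, h2⟩ := PerfectSampling.rejection_sampling hind hXY hS hC.ne'
    exact ⟨h1, hproj.fun_comp h2⟩
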